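/- Let $PW_\pi$ be the Paley–Wiener space of all entire functions $f(z)=\int_{-\pi}^{\pi}\varphi(t)e^{-itz}\,dt$ with $\varphi\in L^2(-\pi,\pi)$, normed by $\|f\|_{L^2(\mathbb R)}$. A positive Borel measure $\mu$ on $\mathbb C$ is called a Carleson measure for $PW_\pi$ if there is a constant $C$ with $\|f\|_{L^2(\mu)}\le C\|f\|_{L^2(\mathbb R)}$ for all $f\in PW_\pi$, and a reverse Carleson measure if there is a constant $C$ with $\|f\|_{L^2(\mathbb R)}\le C\|f\|_{L^2(\mu)}$ for all $f\in PW_\pi$. A set $S\subset\mathbb R$ is called sampling for $PW_\pi$ if $\sum_{s\in S}\delta_s$ is both a Carleson and a reverse Carleson measure for $PW_\pi$, and minimal sampling if moreover no proper subset of $S$ is sampling. For $\lambda\in\mathbb C$ let $k_\lambda(z)=\frac{\sin(\pi(z-\bar\lambda))}{\pi(z-\bar\lambda)}$ (with value $1$ at $z=\bar\lambda$) and $K_\lambda=k_\lambda/\|k_\lambda\|_{L^2(\mathbb R)}$. The reproducing kernel thesis for reverse Carleson inequalities fails in $PW_\pi$. More precisely, for $n\in\mathbb Z\setminus\{0\}$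 let $x_n=n+\frac18$ if $n$ is even and $x_n=n-\frac18$ if $n$ is odd, and let $S=\{x_n: n\neq0\}$ and $\mu=\sum_{n\ne0}\delta_{x_n}$. Then: 1. For every $\lambda\in\mathbb C$, $k_\lambda$ is the reproducing kernel of $PW_\pi$ at $\lambda$, that is, $k_\lambda\in PW_\pi$ and $f(\lambda)=\int_{\mathbb R}f(x)\overline{k_\lambda(x)}\,dx$ (an absolutely convergent integral) for all $f\in PW_\pi$; and $\|K_\lambda\|_{L^2(\mathbb R)}=1$. 2. $S\cup\{0\}$ is minimal sampling for $PW_\pi$, and $S$ is not sampling for $PW_\pi$. 3. $\mu$ is a Carleson measure for $PW_\pi$, but it is not a reverse Carleson measure for $PW_\pi$. 4. There is $\delta>0$ such that $\|K_\lambda\|_{L^2(\mu)}\ge\delta$ for all $\lambda\in\mathbb C$. -/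

import Mathlib

open MeasureTheory Set
open scoped ENNReal NNReal ComplexConjugate

namespace PaleyWiener

/-- A square integrable function on `[-π, π]`, times an exponential, is integrable there. -/
theorem integrable_mul_cexp {φ : ℝ → ℂ}
    (hφ : MemLp φ 2 (volume.restrict (Icc (-Real.pi) Real.pi))) (z : ℂ) :
    IntegrableOn (fun t : ℝ => φ t * Complex.exp (-(Complex.I * t * z)))
      (Icc (-Real.pi) Real.pi) := by
  have h1 : IntegrableOn φ (Icc (-Real.pi) Real.pi) := hφ.integrable (by norm_num)
  exact h1.mul_continuousOn (by fun_prop) isCompact_Icc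

/-- The Paley-Wiener space `PW_π`: the (entire) functions on `ℂ` that are Fourier transforms of
square integrable functions on `[-π, π]`. It carries the norm of `L²(ℝ)`, see `pwNorm`. -/
def PW : Submodule ℂ (ℂ → ℂ) where
  carrier := {f | ∃ φ : ℝ → ℂ, MemLp φ 2 (volume.restrict (Icc (-Real.pi) Real.pi)) ∧
    ∀ z : ℂ, f z = ∫ t in Icc (-Real.pi) Real.pi, φ t * Complex.exp (-(Complex.I * t * z))}
  zero_mem' := ⟨0, MemLp.zero, fun z => by simp⟩
  add_mem' := by
    rintro f g ⟨φ, hφ, hf⟩ ⟨ψ, hψ, hg⟩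
    refine ⟨φ + ψ, hφ.add hψ, fun z => ?_⟩
    simp only [Pi.add_apply, add_mul, hf, hg]
    exact (integral_add (integrable_mul_cexp hφ z) (integrable_mul_cexp hψ z)).symm
  smul_mem' := by
    rintro c f ⟨φ, hφ, hf⟩
    refine ⟨c • φ, hφ.const_smul c, fun z => ?_⟩
    simp only [Pi.smul_apply, smul_eq_mul, hf, mul_assoc]
    exact (integral_const_mul _ _).symm

/-- The norm of `PW_π`, i.e. the norm of the restriction to the real line in `L²(ℝ)`. -/
noncomputable def pwNorm (f : ℂ → ℂ) : ℝ≥0∞ :=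
  eLpNorm (fun x : ℝ => f x) 2 volume

/-- `μ` is a Carleson measure for `PW_π`: `‖f‖_{L²(μ)} ≲ ‖f‖_{L²(ℝ)}` for `f ∈ PW_π`. -/
def IsCarleson (μ : Measure ℂ) : Prop :=
  ∃ C : ℝ≥0, ∀ f ∈ PW, eLpNorm f 2 μ ≤ C * pwNorm f

/-- `μ` is a reverse Carleson measure for `PW_π`: `‖f‖_{L²(ℝ)} ≲ ‖f‖_{L²(μ)}` for `f ∈ PW_π`. -/
def IsReverseCarleson (μ : Measure ℂ) : Prop :=
  ∃ C : ℝ≥0, ∀ f ∈ PW, pwNorm f ≤ C * eLpNorm f 2 μ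

/-- A set `S` of real points is sampling for `PW_π`: `∑_{s ∈ S} |f(s)|² ≃ ‖f‖²` for
`f ∈ PW_π`. -/
def IsSampling (S : Set ℝ) : Prop :=
  IsCarleson (Measure.sum fun s : S => Measure.dirac ((s : ℝ) : ℂ)) ∧
    IsReverseCarleson (Measure.sum fun s : S => Measure.dirac ((s : ℝ) : ℂ))

/-- The entire function `sin z / z`, with value `1` at the origin. -/
noncomputable def csinc (z : ℂ) : ℂ :=
  if z = 0 then 1 else Complex.sin z / z

/-- The function `k_w(z) = sinc(π (z - conj w))`. -/
noncomputable def kernel (w : ℂ) : ℂ → ℂ :=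
  fun z => csinc (Real.pi * (z - conj w))

/-- `k` is the reproducing kernel of `PW_π` at the point `w`. -/
def IsReproducingKernel (w : ℂ) (k : ℂ → ℂ) : Prop :=
  k ∈ PW ∧ ∀ f ∈ PW, Integrable (fun x : ℝ => f x * conj (k x)) ∧
    ∫ x : ℝ, f x * conj (k x) = f w

/-- The normalised kernel `K_w = k_w / ‖k_w‖`. -/
noncomputable def normalizedKernel (w : ℂ) : ℂ → ℂ :=
  fun z => kernel w z / ((pwNorm (kernel w)).toReal : ℂ)

/-- The points `x_n = n + 1/8` for even `n`, and `x_n = n - 1/8` for odd `n`. -/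
noncomputable def point (n : ℤ) : ℝ :=
  if Even n then n + 1 / 8 else n - 1 / 8

/-- The set `S` of the points `x_n`, `n ≠ 0`. -/
def pointSet : Set ℝ := point '' {n : ℤ | n ≠ 0}

/-- The measure `μ = ∑_{n ≠ 0} δ_{x_n}` on `ℂ`. -/
noncomputable def pointMeasure : Measure ℂ :=
  Measure.sum fun n : {n : ℤ // n ≠ 0} => Measure.dirac ((point n : ℝ) : ℂ)

end PaleyWiener

namespace PaleyWiener


/-! The points of S ∪ {0} are the integers, each moved by at most 1/8. Sampling at the integers is,
up to a factor, unitary from L²(-π, π) onto ℓ²(ℤ), by Parseval. Expanding the exponential of the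
displacement in its Taylor series shows that sampling at the moved points differs from it, in the
same normalisation, by an operator of norm at most e^{π/8} - 1 < 1, so it is still an isomorphism
onto ℓ²(ℤ) (`exists_equiv_samples`). Boundedness in both directions makes S ∪ {0} sampling.
Surjectivity gives a nonzero function vanishing at all nodes but one, so no node, in particular not
0, can be dropped.

The kernels nevertheless do not notice that 0 is missing: `exists_norm_csinc_le` bounds |k_λ(0)| by
|k_λ(x_1)| + |k_λ(x_2)|, uniformly in λ. The points x_1 and x_2 are displaced in opposite
directions, so with v = conj λ the numerators of the kernel there are sin(π/8 ± πv), whose sum and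
difference recover cos πv and sin πv. With equal displacements both numerators could vanish at once.
Hence the L²(μ) norm of K_λ controls the full sampling norm, which is bounded below. -/

/-! ### Plancherel and Parseval for band-limited functions. -/

/-- Lebesgue measure on `[-π, π]`. -/
noncomputable abbrev bandMeasure : Measure ℝ := volume.restrict (Icc (-Real.pi) Real.pi)

/-- The Hilbert space `L²(-π, π)`. -/
abbrev BandLp : Type := Lp ℂ 2 bandMeasure

/-- The Fourier transform of a function on `[-π, π]`. -/
noncomputable def bandTransform (φ : ℝ → ℂ) (z : ℂ) : ℂ :=
  ∫ t in Icc (-Real.pi) Real.pi, φ t * Complex.exp (-(Complex.I * t * z))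

theorem bandTransform_congr_ae {φ ψ : ℝ → ℂ} (h : φ =ᵐ[bandMeasure] ψ) :
    bandTransform φ = bandTransform ψ := by
  funext z
  refine integral_congr_ae ?_
  filter_upwards [h] with t ht
  rw [ht]

theorem mem_PW_iff {f : ℂ → ℂ} : f ∈ PW ↔ ∃ φ : BandLp, f = bandTransform φ := by
  constructor
  · rintro ⟨φ, hφ, hf⟩
    exact ⟨hφ.toLp φ, by rw [bandTransform_congr_ae hφ.coeFn_toLp]; exact funext hf⟩
  · rintro ⟨φ, rfl⟩
    exact ⟨φ, Lp.memLp φ, fun z => rfl⟩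

theorem norm_cexp_neg_I_mul_mul (t x : ℝ) : ‖Complex.exp (-(Complex.I * t * x))‖ = 1 := by
  have : -(Complex.I * t * x) = ((-(t * x) : ℝ) : ℂ) * Complex.I := by push_cast; ring
  rw [this, Complex.norm_exp_ofReal_mul_I]

theorem continuous_bandTransform (φ : BandLp) :
    Continuous fun x : ℝ => bandTransform φ x := by
  have hint : Integrable φ bandMeasure := (Lp.memLp φ).integrable (by norm_num)
  refine continuous_of_dominated (bound := fun t => ‖φ t‖) (fun x => ?_) (fun x => ?_)
    hint.norm ?_
  · exact (integrable_mul_cexp (Lp.memLp φ) x).aestronglyMeasurable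
  · exact Filter.Eventually.of_forall fun t => by
      rw [norm_mul, norm_cexp_neg_I_mul_mul, mul_one]
  · exact Filter.Eventually.of_forall fun t => by fun_prop

theorem bandTransform_intCast (φ : ℝ → ℂ) (n : ℤ) :
    bandTransform φ n = (2 * Real.pi : ℝ) *
      fourierCoeffOn (neg_lt_self Real.pi_pos) φ n := by
  have hpi := Real.pi_pos
  rw [fourierCoeffOn_eq_integral, intervalIntegral.integral_of_le (by linarith),
    ← integral_Icc_eq_integral_Ioc, bandTransform, Complex.real_smul, ← mul_assoc,
    ← Complex.ofReal_mul]
  rw [show 2 * Real.pi * (1 / (Real.pi - -Real.pi)) = 1 by field_simp; ring, Complex.ofReal_one,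
    one_mul]
  refine integral_congr_ae (Filter.Eventually.of_forall fun t => ?_)
  simp only [smul_eq_mul]
  rw [mul_comm, fourier_coe_apply]
  congr 2
  have : (Real.pi : ℂ) ≠ 0 := by exact_mod_cast hpi.ne'
  push_cast
  field_simp
  ring

theorem tsum_enorm_bandTransform_intCast {φ : ℝ → ℂ} (hφ : MemLp φ 2 bandMeasure) :
    ∑' n : ℤ, ‖bandTransform φ n‖ₑ ^ 2 =
      ENNReal.ofReal (2 * Real.pi) * ∫⁻ t, ‖φ t‖ₑ ^ 2 ∂bandMeasure := by
  have hpi := Real.pi_pos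
  have hae : bandMeasure = volume.restrict (Ioc (-Real.pi) Real.pi) :=
    restrict_Ioc_eq_restrict_Icc.symm
  have h := hasSum_sq_fourierCoeffOn (neg_lt_self hpi) (hae ▸ hφ)
  have h2 := h.mul_left ((2 * Real.pi) ^ 2)
  have h3 : HasSum (fun n : ℤ => ‖bandTransform φ n‖ ^ 2)
      ((2 * Real.pi) * ∫ t, ‖φ t‖ ^ 2 ∂bandMeasure) := by
    have e1 : (fun n : ℤ => ‖bandTransform φ n‖ ^ 2) = fun n : ℤ =>
        (2 * Real.pi) ^ 2 * ‖fourierCoeffOn (neg_lt_self hpi) φ n‖ ^ 2 := by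
      funext n
      rw [bandTransform_intCast, norm_mul, mul_pow, Complex.norm_real, Real.norm_eq_abs, sq_abs]
    have e2 : (2 * Real.pi) * ∫ t, ‖φ t‖ ^ 2 ∂bandMeasure = (2 * Real.pi) ^ 2 *
        (Real.pi - -Real.pi)⁻¹ • ∫ x in (-Real.pi)..Real.pi, ‖φ x‖ ^ 2 := by
      rw [intervalIntegral.integral_of_le (by linarith), hae, smul_eq_mul, ← mul_assoc]
      congr 1
      field_simp
      ring
    rw [e1, e2]
    exact h2
  have h4 : ∀ z : ℂ, ‖z‖ₑ ^ 2 = ENNReal.ofReal (‖z‖ ^ 2) := fun z => by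
    rw [ENNReal.ofReal_pow (norm_nonneg _), ofReal_norm]
  simp_rw [h4]
  rw [← ENNReal.ofReal_tsum_of_nonneg (fun _ => by positivity) h3.summable, h3.tsum_eq,
    ENNReal.ofReal_mul (by positivity), ofReal_integral_eq_lintegral_ofReal]
  · exact (memLp_two_iff_integrable_sq_norm hφ.aestronglyMeasurable).1 hφ
  · exact Filter.Eventually.of_forall fun t => by positivity

/-- Translating the transform by x multiplies φ by a unimodular exponential, so the sum over any
translate of ℤ is the one over ℤ itself. -/
theorem tsum_enorm_bandTransform_add_intCast (φ : BandLp) (x : ℝ) :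
    ∑' n : ℤ, ‖bandTransform φ ((x + n : ℝ) : ℂ)‖ₑ ^ 2 =
      ENNReal.ofReal (2 * Real.pi) * ∫⁻ t, ‖φ t‖ₑ ^ 2 ∂bandMeasure := by
  have hm : MemLp (fun t : ℝ => φ t * Complex.exp (-(Complex.I * t * x))) 2 bandMeasure := by
    refine (Lp.memLp φ).of_le (integrable_mul_cexp (Lp.memLp φ) x).aestronglyMeasurable
      (Filter.Eventually.of_forall fun t => ?_)
    rw [norm_mul, norm_cexp_neg_I_mul_mul, mul_one]
  have h := tsum_enorm_bandTransform_intCast hm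
  have h1 : ∀ t : ℝ, ‖φ t * Complex.exp (-(Complex.I * t * x))‖ₑ = ‖φ t‖ₑ := fun t => by
    rw [← ofReal_norm, ← ofReal_norm, norm_mul, norm_cexp_neg_I_mul_mul, mul_one]
  simp_rw [h1] at h
  rw [← h]
  refine tsum_congr fun n => ?_
  congr 2
  refine integral_congr_ae (Filter.Eventually.of_forall fun t => ?_)
  simp only [mul_assoc, ← Complex.exp_add]
  congr 2
  push_cast
  ring

theorem lintegral_eq_lintegral_tsum_add_intCast {g : ℝ → ℝ≥0∞} (hg : Measurable g) :
    ∫⁻ x, g x = ∫⁻ x in Ioc 0 1, ∑' n : ℤ, g (x + n) := by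
  rw [lintegral_tsum fun n => by fun_prop, ← setLIntegral_univ, ← iUnion_Ioc_intCast ℝ,
    lintegral_iUnion (fun n => measurableSet_Ioc) (pairwise_disjoint_Ioc_intCast ℝ)]
  refine tsum_congr fun n => ?_
  have := (measurePreserving_add_right (volume : Measure ℝ) (n : ℝ)).setLIntegral_comp_preimage
    (s := Ioc (n : ℝ) (n + 1)) measurableSet_Ioc hg
  rw [← this]
  congr 2
  ext x
  simp

theorem enorm_sq_eq_lintegral (φ : BandLp) : ‖φ‖ₑ ^ 2 = ∫⁻ t, ‖φ t‖ₑ ^ 2 ∂bandMeasure := by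
  rw [Lp.enorm_def, eLpNorm_eq_lintegral_rpow_enorm_toReal (by norm_num) (by norm_num),
    ← ENNReal.rpow_natCast, ← ENNReal.rpow_mul]
  simp

theorem pwNorm_sq (f : ℂ → ℂ) : pwNorm f ^ 2 = ∫⁻ x : ℝ, ‖f x‖ₑ ^ 2 := by
  rw [pwNorm, eLpNorm_eq_lintegral_rpow_enorm_toReal (by norm_num) (by norm_num),
    ← ENNReal.rpow_natCast, ← ENNReal.rpow_mul]
  simp

/-- Plancherel's theorem for band-limited functions. -/
theorem pwNorm_bandTransform_sq (φ : BandLp) :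
    pwNorm (bandTransform φ) ^ 2 = ENNReal.ofReal (2 * Real.pi) * ‖φ‖ₑ ^ 2 := by
  -- Cut ℝ into unit intervals: Parseval on each coset x + ℤ makes the integrand over (0, 1]
  -- constant, so no Fourier inversion on ℝ is needed.
  rw [pwNorm_sq, lintegral_eq_lintegral_tsum_add_intCast
    (by have := (continuous_bandTransform φ).measurable; fun_prop)]
  simp_rw [tsum_enorm_bandTransform_add_intCast, ← enorm_sq_eq_lintegral]
  simp

theorem pwNorm_bandTransform (φ : BandLp) :
    pwNorm (bandTransform φ) = ENNReal.ofReal √(2 * Real.pi) * ‖φ‖ₑ := by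
  refine (ENNReal.pow_right_strictMono two_ne_zero).injective ?_
  rw [pwNorm_bandTransform_sq, mul_pow, ← ENNReal.ofReal_pow (by positivity),
    Real.sq_sqrt (by positivity)]

theorem memLp_bandTransform (φ : BandLp) :
    MemLp (fun x : ℝ => bandTransform φ x) 2 volume := by
  refine ⟨(continuous_bandTransform φ).aestronglyMeasurable, ?_⟩
  change pwNorm (bandTransform φ) < ∞
  rw [pwNorm_bandTransform]
  exact ENNReal.mul_lt_top ENNReal.ofReal_lt_top enorm_lt_top

theorem bandTransform_add (φ ψ : BandLp) :
    bandTransform ⇑(φ + ψ) = bandTransform φ + bandTransform ψ := by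
  rw [bandTransform_congr_ae (Lp.coeFn_add φ ψ)]
  funext z
  simp only [bandTransform, Pi.add_apply, add_mul]
  exact integral_add (integrable_mul_cexp (Lp.memLp φ) z) (integrable_mul_cexp (Lp.memLp ψ) z)

theorem bandTransform_smul (c : ℂ) (φ : BandLp) :
    bandTransform ⇑(c • φ) = c • bandTransform φ := by
  rw [bandTransform_congr_ae (Lp.coeFn_smul c φ)]
  funext z
  simp only [bandTransform, Pi.smul_apply, smul_eq_mul, mul_assoc]
  exact integral_const_mul _ _

/-- The normalised Fourier transform, as a linear isometry `L²(-π, π) → L²(ℝ)`. -/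
noncomputable def bandIsometry : BandLp →ₗᵢ[ℂ] Lp ℂ 2 (volume : Measure ℝ) where
  toFun φ := (((√(2 * Real.pi))⁻¹ : ℝ) : ℂ) • (memLp_bandTransform φ).toLp _
  map_add' φ ψ := by
    rw [← smul_add, ← MemLp.toLp_add]
    congr 2
    funext x
    rw [bandTransform_add]
    rfl
  map_smul' c φ := by
    rw [RingHom.id_apply, smul_comm c, ← MemLp.toLp_const_smul]
    congr 2
    funext x
    rw [bandTransform_smul]
    rfl
  norm_map' φ := by
    have hpos : 0 < √(2 * Real.pi) := by positivity
    change ‖(((√(2 * Real.pi))⁻¹ : ℝ) : ℂ) • (memLp_bandTransform φ).toLp _‖ = ‖φ‖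
    rw [norm_smul, Lp.norm_toLp, Complex.norm_real]
    change _ * (pwNorm (bandTransform φ)).toReal = _
    rw [pwNorm_bandTransform, ENNReal.toReal_mul, ENNReal.toReal_ofReal hpos.le, toReal_enorm,
      Real.norm_of_nonneg (by positivity), inv_mul_cancel_left₀ hpos.ne']

theorem integrable_bandTransform_mul_conj (φ ψ : BandLp) :
    Integrable fun x : ℝ => bandTransform φ x * conj (bandTransform ψ x) :=
  (memLp_bandTransform φ).integrable_mul (memLp_bandTransform ψ).star

/-- Parseval's formula for band-limited functions. -/
theorem integral_bandTransform_mul_conj (φ ψ : BandLp) :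
    ∫ x : ℝ, bandTransform φ x * conj (bandTransform ψ x) =
      (2 * Real.pi : ℝ) * inner ℂ ψ φ := by
  have hpos : 0 < √(2 * Real.pi) := by positivity
  -- Polarisation: a linear isometry preserves inner products, so Plancherel's norm identity already
  -- contains Parseval's formula.
  have h := bandIsometry.inner_map_map ψ φ
  have h1 : ∀ χ : BandLp, (memLp_bandTransform χ).toLp _ =
      (√(2 * Real.pi) : ℂ) • bandIsometry χ := fun χ => by
    change _ = (√(2 * Real.pi) : ℂ) • (((√(2 * Real.pi))⁻¹ : ℝ) : ℂ) •
      (memLp_bandTransform χ).toLp _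
    rw [Complex.ofReal_inv, smul_inv_smul₀ (by exact_mod_cast hpos.ne')]
  have h2 : inner ℂ ((memLp_bandTransform ψ).toLp _) ((memLp_bandTransform φ).toLp _) =
      ∫ x : ℝ, bandTransform φ x * conj (bandTransform ψ x) := by
    rw [L2.inner_def]
    refine integral_congr_ae ?_
    filter_upwards [(memLp_bandTransform φ).coeFn_toLp, (memLp_bandTransform ψ).coeFn_toLp]
      with x hx hy
    rw [hx, hy]
    simp [RCLike.inner_apply]
  rw [← h2, h1, h1, inner_smul_left, inner_smul_right, h, Complex.conj_ofReal, ← mul_assoc, ← Complex.ofReal_mul,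
    Real.mul_self_sqrt (by positivity)]


/-! ### Exponentials, reproducing kernels and the Fourier basis. -/

theorem memLp_cexp_I_mul (w : ℂ) :
    MemLp (fun t : ℝ => Complex.exp (Complex.I * t * w)) 2 bandMeasure := by
  have hc : Continuous fun t : ℝ => Complex.exp (Complex.I * t * w) := by fun_prop
  obtain ⟨C, hC⟩ := isCompact_Icc.exists_bound_of_continuousOn
    (s := Icc (-Real.pi) Real.pi) hc.continuousOn
  exact MemLp.of_bound hc.aestronglyMeasurable C
    ((ae_restrict_iff' measurableSet_Icc).2 (Filter.Eventually.of_forall hC))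

/-- The exponential `t ↦ exp (i t w)` as an element of `L²(-π, π)`. -/
noncomputable def expLp (w : ℂ) : BandLp := (memLp_cexp_I_mul w).toLp _

theorem coeFn_expLp (w : ℂ) :
    expLp w =ᵐ[bandMeasure] fun t : ℝ => Complex.exp (Complex.I * t * w) :=
  (memLp_cexp_I_mul w).coeFn_toLp

/-- Point evaluation is an inner product with an exponential; with Parseval's formula this is the
reproducing property. -/
theorem inner_expLp (w : ℂ) (φ : BandLp) : inner ℂ (expLp w) φ = bandTransform φ (conj w) := by
  rw [L2.inner_def]
  refine integral_congr_ae ?_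
  filter_upwards [coeFn_expLp w] with t ht
  rw [ht, RCLike.inner_apply, ← Complex.exp_conj]
  simp

theorem integral_cexp_eq_csinc (z : ℂ) :
    ∫ t : ℝ in Icc (-Real.pi) Real.pi, Complex.exp (-(Complex.I * t * z)) =
      (2 * Real.pi : ℝ) * csinc (Real.pi * z) := by
  have hpi := Real.pi_pos
  have hpi' : (Real.pi : ℂ) ≠ 0 := by exact_mod_cast hpi.ne'
  rcases eq_or_ne z 0 with rfl | hz
  · simp [csinc, two_mul]
    rw [max_eq_left (by positivity)]
    simp
  rw [integral_Icc_eq_integral_Ioc, ← intervalIntegral.integral_of_le (by linarith), csinc,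
    if_neg (mul_ne_zero hpi' hz)]
  have hc : -(Complex.I * z) ≠ 0 := neg_ne_zero.2 (mul_ne_zero Complex.I_ne_zero hz)
  have := integral_exp_mul_complex (a := -Real.pi) (b := Real.pi) hc
  rw [show (fun t : ℝ => Complex.exp (-(Complex.I * t * z))) =
    fun t : ℝ => Complex.exp (-(Complex.I * z) * t) by funext t; congr 1; ring, this, Complex.sin]
  push_cast
  rw [show -(Complex.I * z) * Real.pi = -(Real.pi * z) * Complex.I by ring,
    show -(Complex.I * z) * -Real.pi = Real.pi * z * Complex.I by ring]
  field_simp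
  rw [Complex.I_sq]
  ring

theorem csinc_neg (z : ℂ) : csinc (-z) = csinc z := by
  by_cases h : z = 0 <;> simp [csinc, h]

theorem bandTransform_expLp (w z : ℂ) :
    bandTransform (expLp w) z = (2 * Real.pi : ℝ) * csinc (Real.pi * (z - w)) := by
  rw [← integral_cexp_eq_csinc, bandTransform_congr_ae (coeFn_expLp w)]
  refine integral_congr_ae (Filter.Eventually.of_forall fun t => ?_)
  simp only [← Complex.exp_add]
  congr 1
  ring

theorem kernel_eq_bandTransform (w : ℂ) :
    kernel w = bandTransform ⇑((((2 * Real.pi)⁻¹ : ℝ) : ℂ) • expLp (conj w)) := by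
  have hpi : (2 * Real.pi) ≠ 0 := by positivity
  rw [bandTransform_smul]
  funext z
  rw [Pi.smul_apply, bandTransform_expLp, smul_eq_mul, ← mul_assoc, ← Complex.ofReal_mul,
    inv_mul_cancel₀ hpi, Complex.ofReal_one, one_mul, kernel]

theorem isReproducingKernel_kernel (w : ℂ) : IsReproducingKernel w (kernel w) := by
  have hpi : (2 * Real.pi) ≠ 0 := by positivity
  refine ⟨mem_PW_iff.2 ⟨_, kernel_eq_bandTransform w⟩, fun f hf => ?_⟩
  obtain ⟨φ, rfl⟩ := mem_PW_iff.1 hf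
  rw [kernel_eq_bandTransform]
  refine ⟨integrable_bandTransform_mul_conj _ _, ?_⟩
  rw [integral_bandTransform_mul_conj, inner_smul_left, Complex.conj_ofReal, inner_expLp,
    ← mul_assoc, ← Complex.ofReal_mul, mul_inv_cancel₀ hpi, Complex.ofReal_one, one_mul,
    Complex.conj_conj]

theorem bandTransform_injective {φ : BandLp} (h : ∀ n : ℤ, bandTransform φ n = 0) : φ = 0 := by
  have h1 := tsum_enorm_bandTransform_intCast (Lp.memLp φ)
  rw [← enorm_sq_eq_lintegral] at h1
  simp only [h, enorm_zero, ne_eq, OfNat.ofNat_ne_zero, not_false_eq_true, zero_pow,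
    tsum_zero] at h1
  simpa [Real.pi_pos.not_ge] using h1.symm

theorem pwNorm_kernel_ne_zero (w : ℂ) : pwNorm (kernel w) ≠ 0 := by
  intro h
  rw [kernel_eq_bandTransform, pwNorm_bandTransform] at h
  have hp : ENNReal.ofReal √(2 * Real.pi) ≠ 0 := by
    rw [ne_eq, ENNReal.ofReal_eq_zero, not_le]
    positivity
  have h0 : (((2 * Real.pi)⁻¹ : ℝ) : ℂ) • expLp (conj w) = 0 :=
    enorm_eq_zero.1 ((mul_eq_zero.1 h).resolve_left hp)
  -- At `conj w` the kernel takes the value 1, so it cannot be the transform of zero.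
  have h1 := congrFun (kernel_eq_bandTransform w) (conj w)
  rw [h0, bandTransform_congr_ae (Lp.coeFn_zero _ _ _)] at h1
  simp [kernel, csinc, bandTransform] at h1

theorem normalizedKernel_eq_smul (w : ℂ) :
    normalizedKernel w = (((pwNorm (kernel w)).toReal : ℂ))⁻¹ • kernel w := by
  funext z
  rw [normalizedKernel, Pi.smul_apply, smul_eq_mul, div_eq_inv_mul]

theorem normalizedKernel_mem_PW (w : ℂ) : normalizedKernel w ∈ PW := by
  rw [normalizedKernel_eq_smul]
  exact PW.smul_mem _ (isReproducingKernel_kernel w).1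

theorem pwNorm_normalizedKernel (w : ℂ) : pwNorm (normalizedKernel w) = 1 := by
  have h0 := pwNorm_kernel_ne_zero w
  have h1 : pwNorm (kernel w) ≠ ∞ := by
    rw [kernel_eq_bandTransform]
    exact (memLp_bandTransform _).2.ne
  rw [normalizedKernel_eq_smul]
  have : pwNorm ((((pwNorm (kernel w)).toReal : ℂ))⁻¹ • kernel w) =
      ‖(((pwNorm (kernel w)).toReal : ℂ))⁻¹‖ₑ * pwNorm (kernel w) :=
    eLpNorm_const_smul _ (fun x : ℝ => kernel w x) 2 volume
  rw [this, ← Complex.ofReal_inv, ← ofReal_norm, Complex.norm_real,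
    Real.norm_of_nonneg (by positivity), ← ENNReal.toReal_inv,
    ENNReal.ofReal_toReal (ENNReal.inv_ne_top.2 h0), ENNReal.inv_mul_cancel h0 h1]

theorem orthonormal_expLp : Orthonormal ℂ fun n : ℤ =>
    (((√(2 * Real.pi))⁻¹ : ℝ) : ℂ) • expLp (n : ℂ) := by
  have hpos : 0 < √(2 * Real.pi) := by positivity
  have hpi : (Real.pi : ℂ) ≠ 0 := by exact_mod_cast Real.pi_ne_zero
  have hsq : (√(2 * Real.pi))⁻¹ * (√(2 * Real.pi))⁻¹ * (2 * Real.pi) = 1 := by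
    rw [← mul_inv, Real.mul_self_sqrt (by positivity), inv_mul_cancel₀ (by positivity)]
  rw [orthonormal_iff_ite]
  intro m n
  rw [inner_smul_left, inner_smul_right, Complex.conj_ofReal, inner_expLp, bandTransform_expLp,
    ← mul_assoc, ← mul_assoc, ← Complex.ofReal_mul, ← Complex.ofReal_mul, hsq,
    Complex.ofReal_one, one_mul]
  have hc : (conj (m : ℂ)) = (m : ℂ) := map_intCast _ m
  rw [hc]
  split_ifs with h
  · simp [h, csinc]
  · have hmn : (m : ℂ) - n ≠ 0 := sub_ne_zero.2 (by exact_mod_cast h)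
    rw [csinc, if_neg (mul_ne_zero hpi hmn), mul_comm (Real.pi : ℂ)]
    have := Complex.sin_int_mul_pi (m - n)
    push_cast at this
    rw [this, zero_div]

/-- The Hilbert basis of normalised exponentials of `L²(-π, π)`. -/
noncomputable def expBasis : HilbertBasis ℤ ℂ BandLp :=
  HilbertBasis.mkOfOrthogonalEqBot orthonormal_expLp <| by
    rw [Submodule.eq_bot_iff]
    intro φ hφ
    refine bandTransform_injective fun n => ?_
    have h := (Submodule.mem_orthogonal _ _).1 hφ _ (Submodule.subset_span ⟨n, rfl⟩)
    have hpos : 0 < √(2 * Real.pi) := by positivity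
    rw [inner_smul_left, inner_expLp, Complex.conj_ofReal, map_intCast] at h
    exact (mul_eq_zero.1 h).resolve_left (by exact_mod_cast (inv_pos.2 hpos).ne')

theorem expBasis_repr_apply (φ : BandLp) (n : ℤ) :
    expBasis.repr φ n = (((√(2 * Real.pi))⁻¹ : ℝ) : ℂ) * bandTransform φ n := by
  rw [HilbertBasis.repr_apply_apply, expBasis, HilbertBasis.coe_mkOfOrthogonalEqBot,
    inner_smul_left, inner_expLp, Complex.conj_ofReal, map_intCast]


/-! ### Perturbation of sampling at the integers. -/

/-- The space of square summable sequences indexed by `ℤ`. -/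
abbrev SeqTwo : Type := lp (fun _ : ℤ => ℂ) 2

theorem memLp_top_ofReal : MemLp (fun t : ℝ => (t : ℂ)) ∞ bandMeasure :=
  MemLp.of_bound Complex.continuous_ofReal.aestronglyMeasurable Real.pi
    ((ae_restrict_iff' measurableSet_Icc).2 (Filter.Eventually.of_forall fun t ht => by
      rw [Complex.norm_real]; exact abs_le.2 ht))

/-- Multiplication by the independent variable on `L²(-π, π)`. -/
noncomputable def mulVar : BandLp →L[ℂ] BandLp :=
  (ContinuousLinearMap.mul ℂ ℂ).holderL bandMeasure ∞ 2 2 memLp_top_ofReal.toLp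

theorem coeFn_mulVar (φ : BandLp) : mulVar φ =ᵐ[bandMeasure] fun t => (t : ℂ) * φ t := by
  filter_upwards [(ContinuousLinearMap.mul ℂ ℂ).coeFn_holder (r := 2) (memLp_top_ofReal.toLp) φ,
    memLp_top_ofReal.coeFn_toLp] with t h1 h2
  rw [mulVar, ContinuousLinearMap.holderL_apply_apply, h1, h2, ContinuousLinearMap.mul_apply']

theorem norm_mulVar_le : ‖mulVar‖ ≤ Real.pi := by
  refine ContinuousLinearMap.opNorm_le_bound _ Real.pi_pos.le fun φ => ?_
  refine Lp.norm_le_mul_norm_of_ae_le_mul ?_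
  filter_upwards [coeFn_mulVar φ, ae_restrict_mem measurableSet_Icc] with t ht hmem
  rw [ht, norm_mul, Complex.norm_real]
  gcongr
  exact abs_le.2 hmem

theorem coeFn_mulVar_pow (k : ℕ) (φ : BandLp) :
    (mulVar ^ k) φ =ᵐ[bandMeasure] fun t => (t : ℂ) ^ k * φ t := by
  induction k with
  | zero => exact Filter.Eventually.of_forall fun t => by simp
  | succ k ih =>
    rw [pow_succ', mul_apply_eq_comp]
    filter_upwards [coeFn_mulVar ((mulVar ^ k) φ), ih] with t h1 h2
    rw [h1, h2]
    ring

/-- Coordinatewise multiplication of square summable sequences by a bounded sequence. -/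
noncomputable def mulSeq (d : ℤ → ℝ) (c : ℝ) (hd : ∀ n, |d n| ≤ c) : SeqTwo →L[ℂ] SeqTwo :=
  have hle : ∀ (a : SeqTwo) (n : ℤ), ‖(d n : ℂ) * a n‖ ≤ ‖(c : ℂ) • a n‖ := fun a n => by
    rw [norm_mul, norm_smul, Complex.norm_real, Complex.norm_real]
    gcongr
    exact (hd n).trans (le_abs_self c)
  have hmem : ∀ a : SeqTwo, Memℓp (fun n => (d n : ℂ) * a n) 2 := fun a =>
    ((lp.memℓp a).const_smul (c : ℂ)).mono' (hle a)
  LinearMap.mkContinuous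
    { toFun := fun a => ⟨fun n => (d n : ℂ) * a n, hmem a⟩
      map_add' := fun a b => by ext n; exact mul_add _ _ _
      map_smul' := fun z a => by ext n; exact mul_left_comm _ _ _ } c fun a => by
    have h := lp.norm_mono (p := 2) (by norm_num)
      (x := (⟨fun n => (d n : ℂ) * a n, hmem a⟩ : SeqTwo)) (y := (c : ℂ) • a) (hle a)
    rwa [norm_smul, Complex.norm_real, Real.norm_of_nonneg ((abs_nonneg _).trans (hd 0))] at h

theorem mulSeq_apply (d : ℤ → ℝ) (c : ℝ) (hd : ∀ n, |d n| ≤ c) (a : SeqTwo) (n : ℤ) :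
    mulSeq d c hd a n = (d n : ℂ) * a n := rfl

theorem norm_mulSeq_le (d : ℤ → ℝ) (c : ℝ) (hd : ∀ n, |d n| ≤ c) : ‖mulSeq d c hd‖ ≤ c := by
  unfold mulSeq
  exact LinearMap.mkContinuous_norm_le _ ((abs_nonneg _).trans (hd 0)) _

theorem mulSeq_pow_apply (d : ℤ → ℝ) (c : ℝ) (hd : ∀ n, |d n| ≤ c) (k : ℕ) (a : SeqTwo) (n : ℤ) :
    (mulSeq d c hd ^ k) a n = (d n : ℂ) ^ k * a n := by
  induction k with
  | zero => simp
  | succ k ih =>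
    rw [pow_succ', mul_apply_eq_comp, mulSeq_apply, ih]
    ring

/-- Multiplying by `√(2π)`, the Fourier transform of `φ` at the integers. -/
noncomputable def intSamples : BandLp →L[ℂ] SeqTwo := expBasis.repr.toContinuousLinearEquiv

theorem norm_intSamples_le : ‖intSamples‖ ≤ 1 :=
  ContinuousLinearMap.opNorm_le_bound _ zero_le_one fun φ => by
    rw [one_mul]
    exact (expBasis.repr.norm_map φ).le

/-- The `k`-th term of the Taylor expansion of the sampling operator at the points `n + d n`. -/
noncomputable def sampleTerm (d : ℤ → ℝ) (c : ℝ) (hd : ∀ n, |d n| ≤ c) (k : ℕ) :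
    BandLp →L[ℂ] SeqTwo :=
  ((-Complex.I) ^ k / (k.factorial : ℂ)) •
    ((mulSeq d c hd ^ k).comp (intSamples.comp (mulVar ^ k)))

theorem norm_sampleTerm_le (d : ℤ → ℝ) (c : ℝ) (hd : ∀ n, |d n| ≤ c) (k : ℕ) :
    ‖sampleTerm d c hd k‖ ≤ (Real.pi * c) ^ k / k.factorial := by
  have hc : 0 ≤ c := (abs_nonneg _).trans (hd 0)
  have h1 : ‖mulSeq d c hd ^ k‖ ≤ c ^ k := by
    -- The bound on the norm of a power is used for positive exponents only; for k = 0 the identity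
    -- has norm at most one.
    rcases k.eq_zero_or_pos with rfl | hk
    · rw [pow_zero, pow_zero]
      exact ContinuousLinearMap.norm_id_le
    · exact (norm_pow_le' _ hk).trans (pow_le_pow_left₀ (norm_nonneg _) (norm_mulSeq_le d c hd) k)
  have h2 : ‖mulVar ^ k‖ ≤ Real.pi ^ k := by
    rcases k.eq_zero_or_pos with rfl | hk
    · rw [pow_zero, pow_zero]
      exact ContinuousLinearMap.norm_id_le
    · exact (norm_pow_le' _ hk).trans (pow_le_pow_left₀ (norm_nonneg _) norm_mulVar_le k)
  have h3 : ‖(mulSeq d c hd ^ k).comp (intSamples.comp (mulVar ^ k))‖ ≤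
      c ^ k * (1 * Real.pi ^ k) := by
    refine (ContinuousLinearMap.opNorm_comp_le _ _).trans ?_
    gcongr
    refine (ContinuousLinearMap.opNorm_comp_le _ _).trans ?_
    gcongr
    exact norm_intSamples_le
  rw [sampleTerm, norm_smul, norm_div, norm_pow, norm_neg, Complex.norm_I, one_pow,
    Complex.norm_natCast, mul_pow]
  calc _ ≤ 1 / (k.factorial : ℝ) * (c ^ k * (1 * Real.pi ^ k)) := by gcongr
    _ = _ := by ring

/-- The factor t^k acts before the integral and `d n ^ k` after it; together they form the k-th
Taylor term of the exponential of `-(I * t * d n)`. -/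
theorem sampleTerm_apply (d : ℤ → ℝ) (c : ℝ) (hd : ∀ n, |d n| ≤ c) (k : ℕ) (φ : BandLp) (n : ℤ) :
    sampleTerm d c hd k φ n = (((√(2 * Real.pi))⁻¹ : ℝ) : ℂ) *
      ∫ t in Icc (-Real.pi) Real.pi, φ t * Complex.exp (-(Complex.I * t * n)) *
        ((-(Complex.I * t * d n)) ^ k / k.factorial) := by
  have h : sampleTerm d c hd k φ n = ((-Complex.I) ^ k / (k.factorial : ℂ)) *
      ((mulSeq d c hd ^ k) (intSamples ((mulVar ^ k) φ)) n) := rfl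
  have h' : intSamples ((mulVar ^ k) φ) n = expBasis.repr ((mulVar ^ k) φ) n := rfl
  rw [h, mulSeq_pow_apply, h', expBasis_repr_apply, bandTransform_congr_ae (coeFn_mulVar_pow k φ),
    bandTransform, mul_left_comm ((d n : ℂ) ^ k), mul_left_comm, ← integral_const_mul,
    ← integral_const_mul]
  congr 1
  refine integral_congr_ae (Filter.Eventually.of_forall fun t => ?_)
  simp only
  rw [show -(Complex.I * t * d n) = -Complex.I * t * d n by ring, mul_pow, mul_pow]
  ring

/-- Sum and integral may be exchanged because the terms are dominated by |φ| (πc)^k / k!, which sums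
to e^{πc} |φ|. -/
theorem hasSum_sampleTerm_apply (d : ℤ → ℝ) (c : ℝ) (hd : ∀ n, |d n| ≤ c) (φ : BandLp) (n : ℤ) :
    HasSum (fun k => sampleTerm d c hd k φ n)
      ((((√(2 * Real.pi))⁻¹ : ℝ) : ℂ) * bandTransform φ ((n + d n : ℝ) : ℂ)) := by
  simp_rw [sampleTerm_apply]
  refine HasSum.mul_left _ ?_
  have hint : Integrable φ bandMeasure := (Lp.memLp φ).integrable (by norm_num)
  have hc : 0 ≤ c := (abs_nonneg _).trans (hd 0)
  have hs : Summable fun k : ℕ => (Real.pi * c) ^ k / k.factorial :=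
    Real.summable_pow_div_factorial _
  refine hasSum_integral_of_dominated_convergence
    (bound := fun k t => ‖φ t‖ * ((Real.pi * c) ^ k / k.factorial)) (fun k => ?_) (fun k => ?_)
    ?_ ?_ ?_
  · refine (integrable_mul_cexp (Lp.memLp φ) n).aestronglyMeasurable.mul ?_
    exact Continuous.aestronglyMeasurable (by fun_prop)
  · filter_upwards [ae_restrict_mem measurableSet_Icc] with t ht
    have := norm_cexp_neg_I_mul_mul t n
    push_cast at this
    rw [norm_mul, norm_mul, this, mul_one, norm_div, norm_pow, norm_neg, norm_mul, norm_mul,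
      Complex.norm_I, one_mul, Complex.norm_real, Complex.norm_real, Complex.norm_natCast]
    gcongr
    · exact abs_le.2 ht
    · exact hd n
  · exact Filter.Eventually.of_forall fun t => hs.mul_left _
  · simp_rw [tsum_mul_left]
    exact hint.norm.mul_const _
  · refine Filter.Eventually.of_forall fun t => ?_
    have h := NormedSpace.expSeries_div_hasSum_exp (-(Complex.I * t * d n))
    rw [← Complex.exp_eq_exp_ℂ] at h
    have h2 := h.mul_left (φ t * Complex.exp (-(Complex.I * t * n)))
    rw [mul_assoc (φ t), ← Complex.exp_add] at h2
    rwa [show -(Complex.I * t * ((n + d n : ℝ) : ℂ)) =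
      -(Complex.I * t * n) + -(Complex.I * t * d n) by push_cast; ring]

/-- If `|d n| ≤ c` with `π c < log 2`, then sampling at the points `n + d n` is an isomorphism
from `L²(-π, π)` onto the space of square summable sequences. -/
theorem exists_equiv_samples (d : ℤ → ℝ) (c : ℝ) (hd : ∀ n, |d n| ≤ c)
    (hc : Real.pi * c < Real.log 2) :
    ∃ B : BandLp ≃L[ℂ] SeqTwo, ∀ (φ : BandLp) (n : ℤ),
      bandTransform φ ((n + d n : ℝ) : ℂ) = (√(2 * Real.pi) : ℝ) * B φ n := by
  have hsum : Summable fun k : ℕ => (Real.pi * c) ^ k / k.factorial :=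
    Real.summable_pow_div_factorial _
  have hsA : Summable (sampleTerm d c hd) := hsum.of_norm_bounded (norm_sampleTerm_le d c hd)
  set A : BandLp →L[ℂ] SeqTwo := ∑' k, sampleTerm d c hd k with hA
  have hAapply : ∀ (φ : BandLp) (n : ℤ), A φ n =
      (((√(2 * Real.pi))⁻¹ : ℝ) : ℂ) * bandTransform φ ((n + d n : ℝ) : ℂ) := fun φ n => by
    refine HasSum.unique ?_ (hasSum_sampleTerm_apply d c hd φ n)
    exact hsA.hasSum.mapL ((lp.evalCLM ℂ (fun _ : ℤ => ℂ) 2 n).comp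
      (ContinuousLinearMap.apply ℂ SeqTwo φ))
  have h0 : sampleTerm d c hd 0 = intSamples := by
    ext1 φ
    simp [sampleTerm]
  -- Dropping the zeroth term leaves a tail of norm at most e^{πc} - 1; this is where log 2 comes
  -- from.
  have hdiff : ‖A - intSamples‖ < 1 := by
    have h1 : A - intSamples = ∑' k, sampleTerm d c hd (k + 1) := by
      rw [hA, hsA.tsum_eq_zero_add, h0, add_sub_cancel_left]
    have h2 : Summable fun k : ℕ => (Real.pi * c) ^ (k + 1) / ((k + 1).factorial : ℝ) :=
      (summable_nat_add_iff 1).2 hsum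
    have h3 : ∑' k : ℕ, (Real.pi * c) ^ (k + 1) / ((k + 1).factorial : ℝ) =
        Real.exp (Real.pi * c) - 1 := by
      rw [Real.exp_eq_exp_ℝ, NormedSpace.exp_eq_tsum_div]
      simp only
      rw [hsum.tsum_eq_zero_add]
      simp
    rw [h1]
    refine (tsum_of_norm_bounded h2.hasSum fun k => norm_sampleTerm_le d c hd (k + 1)).trans_lt ?_
    rw [h3]
    have := Real.exp_lt_exp.2 hc
    rw [Real.exp_log two_pos] at this
    linarith
  let U := expBasis.repr.toContinuousLinearEquiv
  -- Composing with the inverse of the unitary `U` gives an endomorphism within distance less than 1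
  -- of the identity, invertible by a Neumann series.
  let V : BandLp →L[ℂ] BandLp := (U.symm : SeqTwo →L[ℂ] BandLp).comp A
  have hV : IsUnit V := by
    have h1 : 1 - V = -((U.symm : SeqTwo →L[ℂ] BandLp).comp (A - intSamples)) := by
      ext1 φ
      have : U.symm (intSamples φ) = φ := U.symm_apply_apply φ
      simp [V, this]
    have h2 : ‖1 - V‖ < 1 := by
      rw [h1, norm_neg]
      refine lt_of_le_of_lt ?_ hdiff
      refine ContinuousLinearMap.opNorm_le_bound _ (norm_nonneg _) fun φ => ?_
      exact (expBasis.repr.symm.norm_map ((A - intSamples) φ)).trans_le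
        (ContinuousLinearMap.le_opNorm _ _)
    have := isUnit_one_sub_of_norm_lt_one h2
    rwa [sub_sub_cancel] at this
  let e : BandLp ≃L[ℂ] BandLp := ContinuousLinearEquiv.unitsEquiv ℂ BandLp hV.unit
  refine ⟨e.trans U, fun φ n => ?_⟩
  have h1 : (e.trans U) φ = A φ := U.apply_symm_apply (A φ)
  have hpos : 0 < √(2 * Real.pi) := by positivity
  rw [h1, hAapply, ← mul_assoc, ← Complex.ofReal_mul, mul_inv_cancel₀ hpos.ne',
    Complex.ofReal_one, one_mul]


/-! ### The nodes: sampling, minimality, and failure without the origin. -/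

theorem eLpNorm_sum_dirac_sq {ι : Type*} (p : ι → ℂ) (f : ℂ → ℂ) :
    eLpNorm f 2 (Measure.sum fun i => Measure.dirac (p i)) ^ 2 = ∑' i, ‖f (p i)‖ₑ ^ 2 := by
  rw [eLpNorm_eq_lintegral_rpow_enorm_toReal (by norm_num) (by norm_num),
    ← ENNReal.rpow_natCast, ← ENNReal.rpow_mul, lintegral_sum_measure]
  simp [lintegral_dirac]

theorem tsum_enorm_sq (a : SeqTwo) : ∑' n, ‖a n‖ₑ ^ 2 = ‖a‖ₑ ^ 2 := by
  have h := lp.hasSum_norm (p := 2) (by norm_num) a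
  simp only [ENNReal.toReal_ofNat, Real.rpow_ofNat] at h
  have h1 : ∀ n, ‖a n‖ₑ ^ 2 = ENNReal.ofReal (‖a n‖ ^ 2) := fun n => by
    rw [ENNReal.ofReal_pow (norm_nonneg _), ofReal_norm]
  simp_rw [h1]
  rw [← ENNReal.ofReal_tsum_of_nonneg (fun _ => by positivity) h.summable, h.tsum_eq,
    ENNReal.ofReal_pow (norm_nonneg _), ofReal_norm]

/-- The displacement of the `n`-th node of `S ∪ {0}` from the integer `n`. -/
noncomputable def shift (n : ℤ) : ℝ :=
  if n = 0 then 0 else if Even n then 1 / 8 else -(1 / 8)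

/-- The points of `S ∪ {0}`, enumerated by the integers. -/
noncomputable def node (n : ℤ) : ℝ := n + shift n

theorem abs_shift_le (n : ℤ) : |shift n| ≤ 1 / 8 := by
  unfold shift
  split_ifs <;> norm_num

theorem node_zero : node 0 = 0 := by simp [node, shift]

theorem node_of_ne_zero {n : ℤ} (hn : n ≠ 0) : node n = point n := by
  unfold node shift point
  rw [if_neg hn]
  split_ifs <;> ring

theorem node_injective : Function.Injective node := by
  intro m n h
  have hm := abs_le.1 (abs_shift_le m)
  have hn := abs_le.1 (abs_shift_le n)
  unfold node at h
  have h1 : (m : ℝ) < n + 1 := by linarith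
  have h2 : (n : ℝ) < m + 1 := by linarith
  have h1' : m < n + 1 := by exact_mod_cast h1
  have h2' : n < m + 1 := by exact_mod_cast h2
  omega

theorem range_node : range node = insert 0 pointSet := by
  ext x
  constructor
  · rintro ⟨n, rfl⟩
    rcases eq_or_ne n 0 with rfl | hn
    · exact Or.inl node_zero
    · exact Or.inr ⟨n, hn, (node_of_ne_zero hn).symm⟩
  · rintro (rfl | ⟨n, hn, rfl⟩)
    · exact ⟨0, node_zero⟩
    · exact ⟨n, node_of_ne_zero hn⟩

theorem pi_mul_lt_log_two : Real.pi * (1 / 8) < Real.log 2 := by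
  have := Real.pi_lt_four
  have := Real.log_two_gt_d9
  linarith

/-- Sampling at the nodes is an isomorphism from `L²(-π, π)` onto `ℓ²(ℤ)`. -/
theorem exists_equiv_node : ∃ B : BandLp ≃L[ℂ] SeqTwo, ∀ (φ : BandLp) (n : ℤ),
    bandTransform φ (node n) = (√(2 * Real.pi) : ℝ) * B φ n :=
  exists_equiv_samples shift (1 / 8) abs_shift_le pi_mul_lt_log_two

theorem tsum_enorm_node {B : BandLp ≃L[ℂ] SeqTwo}
    (hB : ∀ (φ : BandLp) (n : ℤ), bandTransform φ (node n) = (√(2 * Real.pi) : ℝ) * B φ n)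
    (φ : BandLp) : ∑' n, ‖bandTransform φ (node n)‖ₑ ^ 2 =
      (ENNReal.ofReal √(2 * Real.pi) * ‖B φ‖ₑ) ^ 2 := by
  have h1 : ‖((√(2 * Real.pi) : ℝ) : ℂ)‖ₑ = ENNReal.ofReal √(2 * Real.pi) := by
    rw [← ofReal_norm, Complex.norm_real, Real.norm_of_nonneg (Real.sqrt_nonneg _)]
  simp_rw [hB, enorm_mul, mul_pow]
  rw [ENNReal.tsum_mul_left, tsum_enorm_sq, h1]

theorem exists_tsum_node_le : ∃ C : ℝ≥0, ∀ f ∈ PW,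
    ∑' n, ‖f (node n)‖ₑ ^ 2 ≤ (C * pwNorm f) ^ 2 := by
  obtain ⟨B, hB⟩ := exists_equiv_node
  refine ⟨‖(B : BandLp →L[ℂ] SeqTwo)‖₊, fun f hf => ?_⟩
  obtain ⟨φ, rfl⟩ := mem_PW_iff.1 hf
  rw [tsum_enorm_node hB, pwNorm_bandTransform, mul_left_comm]
  gcongr
  exact (B : BandLp →L[ℂ] SeqTwo).le_opENorm φ

theorem exists_le_tsum_node : ∃ C : ℝ≥0, ∀ f ∈ PW,
    pwNorm f ^ 2 ≤ C ^ 2 * ∑' n, ‖f (node n)‖ₑ ^ 2 := by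
  obtain ⟨B, hB⟩ := exists_equiv_node
  refine ⟨‖(B.symm : SeqTwo →L[ℂ] BandLp)‖₊, fun f hf => ?_⟩
  obtain ⟨φ, rfl⟩ := mem_PW_iff.1 hf
  rw [tsum_enorm_node hB, pwNorm_bandTransform, ← mul_pow, mul_left_comm]
  gcongr
  have h := (B.symm : SeqTwo →L[ℂ] BandLp).le_opENorm (B φ)
  have h2 : (B.symm : SeqTwo →L[ℂ] BandLp) (B φ) = φ := B.symm_apply_apply φ
  rw [h2] at h
  exact h

/-- The free index type serves both sums indexed by a set of reals, as in `IsSampling`, and sums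
indexed by integers, as in `pointMeasure`. -/
theorem isCarleson_sum_dirac {ι : Type*} {p : ι → ℂ} {σ : ι → ℤ} (hσ : Function.Injective σ)
    (hp : ∀ i, p i = node (σ i)) : IsCarleson (Measure.sum fun i => Measure.dirac (p i)) := by
  obtain ⟨C, hC⟩ := exists_tsum_node_le
  refine ⟨C, fun f hf => ?_⟩
  rw [← ENNReal.pow_le_pow_left_iff two_ne_zero, eLpNorm_sum_dirac_sq]
  refine le_trans ?_ (hC f hf)
  simp_rw [hp]
  exact ENNReal.tsum_comp_le_tsum_of_injective hσ fun n => ‖f (node n)‖ₑ ^ 2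

theorem isReverseCarleson_sum_dirac {ι : Type*} {p : ι → ℂ} {σ : ι → ℤ}
    (hσ : Function.Surjective σ) (hp : ∀ i, p i = node (σ i)) :
    IsReverseCarleson (Measure.sum fun i => Measure.dirac (p i)) := by
  obtain ⟨C, hC⟩ := exists_le_tsum_node
  refine ⟨C, fun f hf => ?_⟩
  rw [← ENNReal.pow_le_pow_left_iff two_ne_zero, mul_pow, eLpNorm_sum_dirac_sq]
  refine (hC f hf).trans ?_
  gcongr
  simp_rw [hp]
  exact ENNReal.tsum_le_tsum_comp_of_surjective hσ fun n => ‖f (node n)‖ₑ ^ 2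

/-- The nodes are a complete interpolating sequence: some function of `PW_π` vanishes at all nodes
but one. -/
theorem exists_mem_PW_vanishing (m : ℤ) :
    ∃ f ∈ PW, pwNorm f ≠ 0 ∧ ∀ n, n ≠ m → f (node n) = 0 := by
  obtain ⟨B, hB⟩ := exists_equiv_node
  -- Surjectivity of sampling enters here: the m-th unit sequence is interpolated.
  set φ : BandLp := B.symm (lp.single 2 m 1) with hφ
  refine ⟨bandTransform φ, mem_PW_iff.2 ⟨φ, rfl⟩, fun h => ?_, fun n hn => ?_⟩
  · have hp : ENNReal.ofReal √(2 * Real.pi) ≠ 0 := by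
      rw [ne_eq, ENNReal.ofReal_eq_zero, not_le]
      positivity
    rw [pwNorm_bandTransform] at h
    have h0 : φ = 0 := enorm_eq_zero.1 ((mul_eq_zero.1 h).resolve_left hp)
    have h1 : B φ = lp.single 2 m 1 := B.apply_symm_apply _
    have h2 := lp.single_apply_self (E := fun _ : ℤ => ℂ) 2 m 1
    rw [← h1, h0, map_zero] at h2
    exact zero_ne_one h2
  · rw [hB, hφ, B.apply_symm_apply, lp.single_apply_ne 2 m _ hn, mul_zero]

theorem not_isReverseCarleson_sum_dirac {ι : Type*} {p : ι → ℂ} {σ : ι → ℤ} {m : ℤ}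
    (hσ : ∀ i, σ i ≠ m) (hp : ∀ i, p i = node (σ i)) :
    ¬ IsReverseCarleson (Measure.sum fun i => Measure.dirac (p i)) := by
  rintro ⟨C, hC⟩
  obtain ⟨f, hf, h0, hv⟩ := exists_mem_PW_vanishing m
  have h := hC f hf
  have h1 : eLpNorm f 2 (Measure.sum fun i => Measure.dirac (p i)) = 0 := by
    rw [← pow_eq_zero_iff two_ne_zero, eLpNorm_sum_dirac_sq, ENNReal.tsum_eq_zero]
    intro i
    rw [hp, hv _ (hσ i)]
    simp
  rw [h1, mul_zero] at h
  exact h0 (le_zero_iff.1 h)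

theorem isSampling_insert : IsSampling (insert 0 pointSet) := by
  have h : ∀ s : (insert 0 pointSet : Set ℝ), ∃ n, node n = s :=
    fun s => range_node.symm.subset s.2
  choose σ hσ using h
  have hp : ∀ s : (insert 0 pointSet : Set ℝ), ((s : ℝ) : ℂ) = node (σ s) := fun s => by rw [hσ]
  refine ⟨isCarleson_sum_dirac (σ := σ) (fun s t hst => ?_) hp,
    isReverseCarleson_sum_dirac (σ := σ) (fun n => ?_) hp⟩
  · rw [Subtype.ext_iff, ← hσ, ← hσ, hst]
  · exact ⟨⟨node n, range_node ▸ mem_range_self n⟩, node_injective (hσ _)⟩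

theorem not_isSampling_of_node_notMem {T : Set ℝ} (hT : T ⊆ insert 0 pointSet) {m : ℤ}
    (hm : node m ∉ T) : ¬ IsSampling T := by
  have h : ∀ s : T, ∃ n, node n = s := fun s => range_node.symm.subset (hT s.2)
  choose σ hσ using h
  refine fun hs => not_isReverseCarleson_sum_dirac (σ := σ) (m := m) (fun s hsm => ?_)
    (fun s => by rw [hσ]) hs.2
  exact hm (hsm ▸ hσ s ▸ s.2)

theorem minimal_isSampling : Minimal IsSampling (insert 0 pointSet) := by
  refine ⟨isSampling_insert, fun T hT hle x hx => ?_⟩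
  by_contra hxT
  rw [← range_node] at hx
  obtain ⟨m, rfl⟩ := hx
  exact not_isSampling_of_node_notMem hle hxT hT

theorem not_isSampling_pointSet : ¬ IsSampling pointSet := by
  refine not_isSampling_of_node_notMem (m := 0) (subset_insert _ _) ?_
  rintro ⟨n, hn, h⟩
  rw [← node_of_ne_zero hn] at h
  exact hn (node_injective h)

theorem isCarleson_pointMeasure : IsCarleson pointMeasure :=
  isCarleson_sum_dirac (σ := Subtype.val) Subtype.val_injective fun n => by
    rw [node_of_ne_zero n.2]

theorem not_isReverseCarleson_pointMeasure : ¬ IsReverseCarleson pointMeasure :=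
  not_isReverseCarleson_sum_dirac (σ := Subtype.val) (m := 0) (fun n => n.2) fun n => by
    rw [node_of_ne_zero n.2]

/-! ### The uniform lower bound for normalised kernels. -/

theorem norm_sin_add_norm_cos_ge_one (z : ℂ) : 1 ≤ ‖Complex.sin z‖ + ‖Complex.cos z‖ := by
  have h : 1 ≤ ‖Complex.sin z‖ ^ 2 + ‖Complex.cos z‖ ^ 2 := by
    have := norm_add_le (Complex.sin z ^ 2) (Complex.cos z ^ 2)
    rwa [Complex.sin_sq_add_cos_sq, norm_one, norm_pow, norm_pow] at this
  nlinarith [norm_nonneg (Complex.sin z), norm_nonneg (Complex.cos z)]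

theorem norm_sin_pi_mul (u : ℂ) :
    ‖Complex.sin (Real.pi * u)‖ = Real.pi * ‖u‖ * ‖csinc (Real.pi * u)‖ := by
  have hpi : (Real.pi : ℂ) ≠ 0 := by exact_mod_cast Real.pi_ne_zero
  rcases eq_or_ne u 0 with rfl | hu
  · simp
  · have h0 : ‖u‖ ≠ 0 := norm_ne_zero_iff.2 hu
    rw [csinc, if_neg (mul_ne_zero hpi hu), norm_div, norm_mul, Complex.norm_real,
      Real.norm_of_nonneg Real.pi_pos.le]
    field_simp [Real.pi_ne_zero]

/-- The function is an average of exponentials over [-π, π], each of modulus at most e^π. -/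
theorem norm_csinc_le {z : ℂ} (hz : ‖z‖ ≤ 1) : ‖csinc (Real.pi * z)‖ ≤ Real.exp Real.pi := by
  have hpi := Real.pi_pos
  have h := norm_setIntegral_le_of_norm_le_const (μ := volume) (s := Icc (-Real.pi) Real.pi)
    (f := fun t : ℝ => Complex.exp (-(Complex.I * t * z))) (C := Real.exp Real.pi)
    (by simp) (fun t ht => by
      rw [Complex.norm_exp]
      refine Real.exp_le_exp.2 ((Complex.re_le_norm _).trans ?_)
      rw [norm_neg, norm_mul, norm_mul, Complex.norm_I, one_mul, Complex.norm_real]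
      calc |t| * ‖z‖ ≤ Real.pi * 1 := by
            gcongr
            exact abs_le.2 ht
        _ = Real.pi := mul_one _)
  rw [integral_cexp_eq_csinc, norm_mul, Complex.norm_real, Real.volume_real_Icc_of_le (by linarith),
    Real.norm_of_nonneg (by positivity)] at h
  have h2 : 2 * Real.pi * ‖csinc (Real.pi * z)‖ ≤ 2 * Real.pi * Real.exp Real.pi := by
    linarith
  exact le_of_mul_le_mul_left h2 (by positivity)

/-- For |v| ≥ 1 the three denominators are comparable up to a constant in the direction needed, and
sin πv is a multiple of the difference of the two numerators on the right. For |v| ≤ 1 the left side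
is bounded, while the numerators on the right cannot both be small, since sin πv and cos πv cannot.
-/
theorem exists_norm_csinc_le : ∃ C : ℝ, 0 ≤ C ∧ ∀ v : ℂ, ‖csinc (Real.pi * (0 - v))‖ ≤
    C * (‖csinc (Real.pi * (7 / 8 - v))‖ + ‖csinc (Real.pi * (17 / 8 - v))‖) := by
  have hpi := Real.pi_pos
  have hs : 0 < Real.sin (Real.pi / 8) := Real.sin_pos_of_pos_of_lt_pi (by linarith) (by linarith)
  have hsc : Real.sin (Real.pi / 8) ≤ Real.cos (Real.pi / 8) := by
    rw [← Real.cos_pi_div_two_sub]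
    exact Real.cos_le_cos_of_nonneg_of_le_pi (by linarith) (by linarith) (by linarith)
  have hc : 1 / 2 ≤ Real.cos (Real.pi / 8) := by
    rw [← Real.cos_pi_div_three]
    exact Real.cos_le_cos_of_nonneg_of_le_pi (by linarith) (by linarith) (by linarith)
  -- The first entry serves |v| ≥ 1, where both distances are at most 4|v| and 2 cos(π/8) ≥ 1; the
  -- second serves |v| ≤ 1, where both distances are at most 4.
  refine ⟨max 4 (Real.exp Real.pi * (4 * Real.pi / Real.sin (Real.pi / 8))),
    le_max_of_le_left (by norm_num), fun v => ?_⟩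
  set k₁ := ‖csinc (Real.pi * (7 / 8 - v))‖
  set k₂ := ‖csinc (Real.pi * (17 / 8 - v))‖
  have hk₁ : 0 ≤ k₁ := norm_nonneg _
  have hk₂ : 0 ≤ k₂ := norm_nonneg _
  set a := Complex.sin (Real.pi * (7 / 8 - v)) with ha
  set b := Complex.sin (Real.pi * (17 / 8 - v)) with hb
  have ha1 : a = Complex.sin ((Real.pi / 8 : ℝ) + Real.pi * v) := by
    rw [ha, ← Complex.sin_pi_sub]
    congr 1
    push_cast
    ring
  have hb1 : b = Complex.sin ((Real.pi / 8 : ℝ) - Real.pi * v) := by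
    rw [hb, ← Complex.sin_sub_two_pi]
    congr 1
    push_cast
    ring
  have hdiff : a - b = 2 * ((Real.cos (Real.pi / 8) : ℝ) * Complex.sin (Real.pi * v)) := by
    rw [ha1, hb1, Complex.sin_add, Complex.sin_sub, Complex.ofReal_cos]
    ring
  have hsum : a + b = 2 * ((Real.sin (Real.pi / 8) : ℝ) * Complex.cos (Real.pi * v)) := by
    rw [ha1, hb1, Complex.sin_add, Complex.sin_sub, Complex.ofReal_sin]
    ring
  have h1 : 2 * (Real.cos (Real.pi / 8) * ‖Complex.sin (Real.pi * v)‖) ≤ ‖a‖ + ‖b‖ := by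
    have := norm_sub_le a b
    rwa [hdiff, norm_mul, norm_mul, Complex.norm_real, Real.norm_of_nonneg (by linarith),
      Complex.norm_ofNat] at this
  have h2 : 2 * (Real.sin (Real.pi / 8) * ‖Complex.cos (Real.pi * v)‖) ≤ ‖a‖ + ‖b‖ := by
    have := norm_add_le a b
    rwa [hsum, norm_mul, norm_mul, Complex.norm_real, Real.norm_of_nonneg hs.le,
      Complex.norm_ofNat] at this
  have hna : ‖a‖ = Real.pi * ‖7 / 8 - v‖ * k₁ := norm_sin_pi_mul _
  have hnb : ‖b‖ = Real.pi * ‖17 / 8 - v‖ * k₂ := norm_sin_pi_mul _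
  have hd₁ : ‖7 / 8 - v‖ ≤ 7 / 8 + ‖v‖ := by
    refine (norm_sub_le _ _).trans_eq ?_
    norm_num
  have hd₂ : ‖17 / 8 - v‖ ≤ 17 / 8 + ‖v‖ := by
    refine (norm_sub_le _ _).trans_eq ?_
    norm_num
  have hbound : ∀ r : ℝ, 7 / 8 + ‖v‖ ≤ r → 17 / 8 + ‖v‖ ≤ r →
      ‖a‖ + ‖b‖ ≤ Real.pi * r * (k₁ + k₂) := fun r hr₁ hr₂ => by
    rw [hna, hnb, mul_add]
    gcongr <;> linarith
  rw [zero_sub, mul_neg, csinc_neg]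
  rcases le_total 1 ‖v‖ with hv | hv
  · refine le_trans ?_ (mul_le_mul_of_nonneg_right (le_max_left _ _) (by positivity))
    have h3 : Real.pi * ‖v‖ * ‖csinc (Real.pi * v)‖ ≤ Real.pi * (4 * ‖v‖) * (k₁ + k₂) := by
      rw [← norm_sin_pi_mul]
      refine le_trans ?_ (hbound (4 * ‖v‖) (by linarith) (by linarith))
      nlinarith [norm_nonneg (Complex.sin (Real.pi * v))]
    refine le_of_mul_le_mul_left ?_ (show 0 < Real.pi * ‖v‖ by positivity)
    linarith
  · refine le_trans ?_ (mul_le_mul_of_nonneg_right (le_max_right _ _) (by positivity))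
    have h3 : Real.sin (Real.pi / 8) ≤ 4 * Real.pi * (k₁ + k₂) := by
      have h4 := hbound 4 (by linarith) (by linarith)
      have h5 := norm_sin_add_norm_cos_ge_one (Real.pi * v)
      -- As sin(π/8) ≤ cos(π/8), adding `h1` and `h2` bounds sin(π/8) (|sin πv| + |cos πv|) by |a| +
      -- |b|.
      nlinarith [norm_nonneg (Complex.sin (Real.pi * v))]
    rw [mul_assoc]
    refine (norm_csinc_le hv).trans (le_mul_of_one_le_right (Real.exp_pos _).le ?_)
    rw [div_mul_eq_mul_div, one_le_div hs]
    exact h3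

/-- Normalisation multiplies all three values by the same scalar, so the constant for the
unnormalised kernels survives. -/
theorem exists_enorm_normalizedKernel_zero_le : ∃ C : ℝ≥0, ∀ w : ℂ,
    ‖normalizedKernel w 0‖ₑ ≤
      C * (‖normalizedKernel w (point 1)‖ₑ + ‖normalizedKernel w (point 2)‖ₑ) := by
  obtain ⟨C, hC, h⟩ := exists_norm_csinc_le
  lift C to ℝ≥0 using hC
  refine ⟨C, fun w => ?_⟩
  have h1 : ((point 1 : ℝ) : ℂ) = 7 / 8 := by
    rw [point, if_neg (by decide)]
    norm_num
  have h2 : ((point 2 : ℝ) : ℂ) = 17 / 8 := by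
    rw [point, if_pos (by decide)]
    norm_num
  have h3 : ‖kernel w 0‖ₑ ≤
      C * (‖kernel w (point 1)‖ₑ + ‖kernel w (point 2)‖ₑ) := by
    have := h (conj w)
    rw [h1, h2, enorm_eq_nnnorm, enorm_eq_nnnorm, enorm_eq_nnnorm]
    exact_mod_cast this
  simp only [normalizedKernel_eq_smul, Pi.smul_apply, smul_eq_mul, enorm_mul]
  rw [← mul_add, mul_left_comm]
  gcongr

theorem tsum_node_eq (g : ℤ → ℝ≥0∞) :
    ∑' n, g n = g 0 + ∑' n : {n : ℤ // n ≠ 0}, g n := by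
  have h := Summable.tsum_add_tsum_compl (f := g) (s := {0}) ENNReal.summable ENNReal.summable
  rw [tsum_singleton] at h
  exact h.symm

theorem enorm_le_eLpNorm_pointMeasure (f : ℂ → ℂ) {n : ℤ} (hn : n ≠ 0) :
    ‖f (point n)‖ₑ ≤ eLpNorm f 2 pointMeasure := by
  rw [← ENNReal.pow_le_pow_left_iff two_ne_zero, pointMeasure, eLpNorm_sum_dirac_sq]
  exact ENNReal.le_tsum (f := fun n : {n : ℤ // n ≠ 0} => ‖f (point n)‖ₑ ^ 2) ⟨n, hn⟩

theorem exists_le_eLpNorm_normalizedKernel : ∃ δ : ℝ, 0 < δ ∧ ∀ w : ℂ,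
    ENNReal.ofReal δ ≤ eLpNorm (normalizedKernel w) 2 pointMeasure := by
  obtain ⟨C, hC⟩ := exists_le_tsum_node
  obtain ⟨D, hD⟩ := exists_enorm_normalizedKernel_zero_le
  -- `C` comes from sampling at all nodes and `D * 2` from replacing the value at 0 by values at two
  -- other nodes; the last `+ 1` only makes the constant positive, hence invertible.
  have key : ∀ w, 1 ≤ ((C * (D * 2 + 1) + 1 : ℝ≥0) : ℝ≥0∞) *
      eLpNorm (normalizedKernel w) 2 pointMeasure := fun w => by
    set E := eLpNorm (normalizedKernel w) 2 pointMeasure with hE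
    have h0 : ‖normalizedKernel w 0‖ₑ ≤ D * 2 * E := by
      refine (hD w).trans ?_
      rw [mul_assoc, two_mul]
      gcongr
      · exact enorm_le_eLpNorm_pointMeasure _ one_ne_zero
      · exact enorm_le_eLpNorm_pointMeasure _ two_ne_zero
    have h1 : ∑' n, ‖normalizedKernel w (node n)‖ₑ ^ 2 =
        ‖normalizedKernel w 0‖ₑ ^ 2 + E ^ 2 := by
      rw [tsum_node_eq, node_zero, Complex.ofReal_zero, hE, pointMeasure, eLpNorm_sum_dirac_sq]
      congr 1
      exact tsum_congr fun n => by rw [node_of_ne_zero n.2]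
    have h2 := hC _ (normalizedKernel_mem_PW w)
    rw [pwNorm_normalizedKernel, h1, one_pow] at h2
    have h3 : (1 : ℝ≥0∞) ≤ (C * ((D * 2 + 1) * E)) ^ 2 := by
      refine h2.trans ?_
      rw [mul_pow]
      gcongr
      calc _ ≤ (D * 2 * E) ^ 2 + E ^ 2 := by gcongr
        _ ≤ (D * 2 * E + E) ^ 2 := by
          rw [add_sq]
          gcongr
          exact le_self_add
        _ = _ := by rw [add_mul, one_mul]
    have h4 : (1 : ℝ≥0∞) ≤ C * ((D * 2 + 1) * E) := by
      rwa [← ENNReal.pow_le_pow_left_iff two_ne_zero, one_pow]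
    refine h4.trans ?_
    rw [← mul_assoc]
    push_cast
    gcongr
    exact le_self_add
  set M : ℝ≥0 := C * (D * 2 + 1) + 1
  have hM : 0 < M := by positivity
  refine ⟨(M⁻¹ : ℝ≥0), by positivity, fun w => ?_⟩
  rw [ENNReal.ofReal_coe_nnreal, ENNReal.coe_inv hM.ne', ← one_div]
  exact ENNReal.div_le_of_le_mul' (key w)

end PaleyWiener

theorem mainTheorem3 :
    -- `k_w` is the reproducing kernel of `PW_π` at `w`, and `K_w` has norm one
    (∀ w : ℂ, PaleyWiener.IsReproducingKernel w (PaleyWiener.kernel w) ∧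
      PaleyWiener.pwNorm (PaleyWiener.normalizedKernel w) = 1) ∧
    -- `S ∪ {0}` is a minimal sampling set, while `S` is not sampling
    Minimal PaleyWiener.IsSampling (insert 0 PaleyWiener.pointSet) ∧
    ¬ PaleyWiener.IsSampling PaleyWiener.pointSet ∧
    -- `μ` is a Carleson measure, but not a reverse Carleson measure
    PaleyWiener.IsCarleson PaleyWiener.pointMeasure ∧
    ¬ PaleyWiener.IsReverseCarleson PaleyWiener.pointMeasure ∧
    -- the norms of the normalised kernels in `L²(μ)` are bounded below
    ∃ δ : ℝ, 0 < δ ∧ ∀ w : ℂ, ENNReal.ofReal δ ≤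
      eLpNorm (PaleyWiener.normalizedKernel w) 2 PaleyWiener.pointMeasure := by
  exact ⟨fun w => ⟨PaleyWiener.isReproducingKernel_kernel w,
      PaleyWiener.pwNorm_normalizedKernel w⟩, PaleyWiener.minimal_isSampling,
    PaleyWiener.not_isSampling_pointSet, PaleyWiener.isCarleson_pointMeasure,
    PaleyWiener.not_isReverseCarleson_pointMeasure,
    PaleyWiener.exists_le_eLpNorm_normalizedKernel⟩
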